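/- All toposes are elementary toposes: categories with finite limits, exponentials and a subobject classifier. A functor between toposes is \emph{regular} if it preserves finite limits and regular epimorphisms. A \emph{tripos} over a topos $\mathcal S$ is a finite-limit-preserving functor $F:\mathcal S\to\mathcal E$ into a topos $\mathcal E$ such that every object $A$ of $\mathcal E$ is a subquotient of $FI$ for some object $I$ of $\mathcal S$, i.e. there are a monomorphism $C\rightarrowtail FI$ and an epimorphism $C\twoheadrightarrow A$ for some object $C$ of $\mathcal E$. A tripos $F$ is \emph{regular} if it preserves epimorphisms. It is \emph{traditional} if there are an object $\Sigma$ of $\mathcal S$ and a monomorphism $t:T\rightarrowtail F\Sigma$ such that for every object $I$ of $\mathcal S$ every monomorphism $m:P\rightarrowtail FI$ is a pullback of $t$ along $Fp$ for some (not necessarily unique) morphism $p:I\to\Sigma$. **Theorem.** Let $\mathcal S$, $\mathcal E_1$, $\mathcal E_2$ be toposes, let $F_1:\mathcal S\to\mathcal E_1$ be a traditional regular tripos and let $H:\mathcal E_1\to\mathcal E_2$ be a regular functor. Then $H$ is a traditional regular tripos (over $\mathcal E_1$) if and only if the composite $HF_1:\mathcal S\to\mathcal E_2$ is a traditional regular tripos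 (over $\mathcal S$). -/

import Mathlib

open CategoryTheory CategoryTheory.Limits

universe v₀ v₁ v₂ u₀ u₁ u₂

/-- A category is an (elementary) topos if it has finite limits, is cartesian closed
(every functor `X × -` has a right adjoint) and has a subobject classifier. -/
class IsTopos (C : Type u₀) [Category.{v₀} C] : Prop where
  hasFiniteLimits : HasFiniteLimits C
  hasExponentials : ∀ X : C, (prod.functor.obj X).IsLeftAdjoint
  hasSubobjectClassifier : HasSubobjectClassifier C

attribute [instance] IsTopos.hasFiniteLimits IsTopos.hasExponentials
  IsTopos.hasSubobjectClassifier

/-- A functor is regular if it preserves finite limits and regular epimorphisms. -/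
structure IsRegularFunctor {C : Type u₀} [Category.{v₀} C] {D : Type u₁} [Category.{v₁} D]
    (F : C ⥤ D) : Prop where
  preservesFiniteLimits : PreservesFiniteLimits F
  map_regularEpi : ∀ {X Y : C} (f : X ⟶ Y), IsRegularEpi f → IsRegularEpi (F.map f)

/-- `A` is a subquotient of `B`: there are a mono `m : C ⟶ B` and an epi `e : C ⟶ A`. -/
def IsSubquotient {E : Type u₀} [Category.{v₀} E] (A B : E) : Prop :=
  ∃ (C : E) (m : C ⟶ B) (e : C ⟶ A), Mono m ∧ Epi e

/-- A tripos over a topos `S`: a finite limit preserving functor `F` from `S` to a topos `E` such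
that every object of `E` is a subquotient of some `F I`. -/
structure IsTripos {S : Type u₀} [Category.{v₀} S] [IsTopos S]
    {E : Type u₁} [Category.{v₁} E] [IsTopos E] (F : S ⥤ E) : Prop where
  preservesFiniteLimits : PreservesFiniteLimits F
  exists_isSubquotient : ∀ A : E, ∃ I : S, IsSubquotient A (F.obj I)

/-- A mono `t : T ⟶ F Σ` is a generic family for the fibered preorder `F^* Sub_E` if every mono
`m : P ⟶ F I` is a pullback of `t` along `F p` for some (not necessarily unique) `p : I ⟶ Σ`. -/
def IsGenericFamily {S : Type u₀} [Category.{v₀} S] {E : Type u₁} [Category.{v₁} E] (F : S ⥤ E)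
    {Sg : S} {T : E} (t : T ⟶ F.obj Sg) : Prop :=
  Mono t ∧ ∀ (I : S) (P : E) (m : P ⟶ F.obj I), Mono m →
    ∃ (p : I ⟶ Sg) (q : P ⟶ T), IsPullback q m t (F.map p)

/-- A traditional regular tripos: a tripos that is traditional (it admits a generic family) and
regular (it preserves epimorphisms). -/
structure IsTraditionalRegularTripos {S : Type u₀} [Category.{v₀} S] [IsTopos S]
    {E : Type u₁} [Category.{v₁} E] [IsTopos E] (F : S ⥤ E) : Prop where
  isTripos : IsTripos F
  traditional : ∃ (Sg : S) (T : E) (t : T ⟶ F.obj Sg), IsGenericFamily F t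
  regular : F.PreservesEpimorphisms

/-!
The proof uses three facts about a topos, all obtained from exponentials and the classifier `Ω`:
epi-mono factorisations exist (`exists_image`), epimorphisms are stable under pullback
(`epi_snd_of_isPullback`), and every epimorphism is regular (`isRegularEpi_of_epi`). The last one
shows that a regular functor preserves epimorphisms. Stability under pullback gives the local
description of images used throughout: a generalised element belongs to the image of `w` if and only
if it lifts through `w` after passing to an epimorphic cover (`exists_mem_image`).

Finite limits, epimorphisms and subquotients transfer directly between `H` and `F₁ ⋙ H`; the
content is the transfer of generic families. Every object `B` of `E₁` is covered by a subobject `C`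
of some `F₁ I`.

* From a generic family `t` over `Σ` for `F₁ ⋙ H` to one for `H` (`IsGenericFamily.of_comp`): the
  inverse image on `H C` of a predicate `P` on `H B` is classified by some `p : I ⟶ Σ`. Although `p`
  need not descend to `B`, the assignment `b ↦ {p i | i ∈ C lies over b}` is a morphism from `B` to
  the power object of `F₁ Σ`, and `P` is the pullback along it of the predicate
  `{s | ∃ j ∈ s, t j}`.
* From generic families `t₁` over `Σ₁` for `F₁` and `t` over `Σ` for `H` to one for `F₁ ⋙ H`
  (`IsGenericFamily.comp`): now `Σ` is covered by a subobject `C` of some `F₁ J`. A predicate on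
  `H (F₁ I)` is classified by some `p : F₁ I ⟶ Σ`, which need not come from `S`, but the relation
  `{(j, i) | j ∈ C lies over p i}` is classified by a morphism `J ⨯ I ⟶ Σ₁`, that is, by a morphism
  from `I` to the exponential `Σ₁ ^ J`.

In both cases the new generic family is an image `{s | ∃ j, ε(j, s) ∧ τ(j)}` in `E₂`, whose
pullbacks are computed in `exists_mono_forall_mem_map_iff`.
-/

/-! ### Generalised elements of subobjects -/

/-- The generalised element `x` of `B` belongs to the subobject `m : U ⟶ B`, i.e. `x` factors
through `m`. For a morphism `m` that is not mono it says that `x` lifts through `m`, which is stronger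
than membership in the image of `m`. -/
def Mem {C : Type u₀} [Category.{v₀} C] {X U B : C} (x : X ⟶ B) (m : U ⟶ B) : Prop :=
  ∃ y : X ⟶ U, y ≫ m = x

section Membership

variable {C : Type u₀} [Category.{v₀} C]

lemma Mem.precomp {X U B : C} {x : X ⟶ B} {m : U ⟶ B} (h : Mem x m) {Y : C} (y : Y ⟶ X) :
    Mem (y ≫ x) m := by
  obtain ⟨z, rfl⟩ := h
  exact ⟨y ≫ z, Category.assoc _ _ _⟩

lemma Mem.self {U B : C} (m : U ⟶ B) : Mem m m := ⟨𝟙 _, Category.id_comp _⟩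

lemma mem_iff_of_isPullback {P T B Z : C} {q : P ⟶ T} {m : P ⟶ B} {t : T ⟶ Z} {p : B ⟶ Z}
    (h : IsPullback q m t p) {X : C} (x : X ⟶ B) : Mem x m ↔ Mem (x ≫ p) t := by
  constructor
  · rintro ⟨y, rfl⟩
    exact ⟨y ≫ q, by simp [h.w]⟩
  · rintro ⟨y, hy⟩
    exact ⟨h.lift y x hy, by simp⟩

/-- A square of monomorphisms is a pullback as soon as membership in `m` is membership in `t`
after composing with `p`. -/
lemma exists_isPullback_of_mem_iff {P T B Z : C} {m : P ⟶ B} {t : T ⟶ Z} [Mono m] [Mono t]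
    {p : B ⟶ Z} (h : ∀ ⦃X : C⦄ (x : X ⟶ B), Mem x m ↔ Mem (x ≫ p) t) :
    ∃ q : P ⟶ T, IsPullback q m t p := by
  obtain ⟨q, hq⟩ := (h m).1 (Mem.self m)
  refine ⟨q, IsPullback.mk' hq (fun X φ φ' _ h₂ ↦ (cancel_mono m).1 h₂) fun X a b hab ↦ ?_⟩
  obtain ⟨l, hl⟩ := (h b).2 ⟨a, hab⟩
  refine ⟨l, ?_, hl⟩
  rw [← cancel_mono t, Category.assoc, hq, reassoc_of% hl, hab]

variable [HasSubobjectClassifier C]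

lemma mem_iff_mem_truth {X U B : C} (m : U ⟶ B) [Mono m] (x : X ⟶ B) :
    Mem x m ↔ Mem (x ≫ HasSubobjectClassifier.χ m) (HasSubobjectClassifier.truth C) :=
  mem_iff_of_isPullback (HasSubobjectClassifier.isPullback_χ m).flip x

lemma mem_truth_iff {X : C} (φ : X ⟶ HasSubobjectClassifier.Ω C) :
    Mem φ (HasSubobjectClassifier.truth C) ↔
      φ = Subobject.Classifier.χ₀ _ X ≫ HasSubobjectClassifier.truth C := by
  constructor
  · rintro ⟨y, rfl⟩
    congr 1
    exact Subsingleton.elim _ _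
  · rintro rfl
    exact ⟨_, rfl⟩

/-- A morphism to `Ω` is the characteristic map of `m` as soon as the generalised elements it sends
to `truth` are those of `m`. -/
lemma χ_eq_of_mem_iff {U B : C} (m : U ⟶ B) [Mono m] (φ : B ⟶ HasSubobjectClassifier.Ω C)
    (h : ∀ ⦃X : C⦄ (x : X ⟶ B),
      Mem x m ↔ Mem (x ≫ φ) (HasSubobjectClassifier.truth C)) :
    HasSubobjectClassifier.χ m = φ := by
  obtain ⟨q, hq⟩ := exists_isPullback_of_mem_iff h
  rw [Subsingleton.elim q (Subobject.Classifier.χ₀ _ U)] at hq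
  exact (HasSubobjectClassifier.unique m φ hq.flip).symm

lemma hom_Ω_ext [HasPullbacks C] {B : C} {φ ψ : B ⟶ HasSubobjectClassifier.Ω C}
    (h : ∀ ⦃X : C⦄ (x : X ⟶ B), Mem (x ≫ φ) (HasSubobjectClassifier.truth C) ↔
      Mem (x ≫ ψ) (HasSubobjectClassifier.truth C)) : φ = ψ := by
  have hφ {X : C} (x : X ⟶ B) := mem_iff_of_isPullback
    (IsPullback.of_hasPullback φ (HasSubobjectClassifier.truth C)).flip x
  rw [← χ_eq_of_mem_iff (pullback.fst φ (HasSubobjectClassifier.truth C)) φ fun X x ↦ hφ x]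
  exact χ_eq_of_mem_iff _ ψ fun X x ↦ (hφ x).trans (h x)

/-- Membership in a subobject is local for the covers given by epimorphisms. -/
lemma Mem.of_epi {X Y U B : C} {c : Y ⟶ X} [Epi c] {x : X ⟶ B} {m : U ⟶ B} [Mono m]
    (h : Mem (c ≫ x) m) : Mem x m := by
  obtain ⟨y, hy⟩ := h
  have := strongMono_of_mono m
  have sq : CommSq y c m x := ⟨hy⟩
  exact ⟨sq.lift, sq.fac_right⟩

end Membership

/-! ### Exponentials, images and epimorphisms in a topos -/

section Topos

variable {C : Type u₀} [Category.{v₀} C] [IsTopos C]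

open HasSubobjectClassifier

lemma exists_exponential (J Y : C) :
    ∃ (E : C) (ev : J ⨯ E ⟶ Y), ∀ ⦃X : C⦄ (f : J ⨯ X ⟶ Y),
      ∃! g : X ⟶ E, prod.map (𝟙 J) g ≫ ev = f := by
  have := IsTopos.hasExponentials J
  let adj := Adjunction.ofIsLeftAdjoint (prod.functor.obj J)
  refine ⟨_, adj.counit.app Y, fun X f ↦ ⟨adj.homEquiv _ _ f, ?_, fun g hg ↦ ?_⟩⟩
  · have := adj.homEquiv_counit (g := adj.homEquiv _ _ f)
    exact this.symm.trans (Equiv.symm_apply_apply _ _)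
  · rw [← hg]
    have := adj.homEquiv_counit (g := g)
    rw [Equiv.symm_apply_eq] at this
    exact this

/-- Universal quantification of a predicate `φ` on `J ⨯ X` along the projection to `X`. -/
lemma exists_forall {J X : C} (φ : J ⨯ X ⟶ Ω C) :
    ∃ (U : C) (m : U ⟶ X), Mono m ∧ ∀ ⦃Y : C⦄ (x : Y ⟶ X),
      Mem x m ↔ ∀ ⦃Z : C⦄ (a : Z ⟶ J) (y : Z ⟶ Y), Mem (prod.lift a (y ≫ x) ≫ φ) (truth C) := by
  obtain ⟨E, ev, hE⟩ := exists_exponential J (Ω C)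
  obtain ⟨f, hf, -⟩ := hE φ
  obtain ⟨g, hg, -⟩ := hE (Subobject.Classifier.χ₀ _ (J ⨯ X) ≫ truth C)
  refine ⟨_, equalizer.ι f g, inferInstance, fun Y x ↦ ?_⟩
  constructor
  · rintro ⟨l, rfl⟩ Z a y
    rw [mem_truth_iff, ← hf, prod.lift_map_assoc, Category.assoc, Category.assoc,
      equalizer.condition, ← Category.assoc l, ← Category.assoc y, ← prod.lift_map_assoc, hg,
      ← Category.assoc]
    congr 1
    exact Subsingleton.elim _ _
  · intro h
    suffices x ≫ f = x ≫ g from ⟨equalizer.lift x this, equalizer.lift_ι _ _⟩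
    refine (hE (prod.map (𝟙 J) (x ≫ f) ≫ ev)).unique rfl ?_
    have h₁ : prod.map (𝟙 J) x ≫ φ = Subobject.Classifier.χ₀ _ (J ⨯ Y) ≫ truth C := by
      rw [← mem_truth_iff]
      convert! h prod.fst prod.snd using 2
      ext <;> simp [prod.lift_fst, prod.lift_snd]
    have h₂ (k : X ⟶ E) : prod.map (𝟙 J) (x ≫ k) = prod.map (𝟙 J) x ≫ prod.map (𝟙 J) k := by
      ext <;> simp
    rw [h₂, h₂, Category.assoc, Category.assoc, hf, hg, h₁, ← Category.assoc]
    congr 1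
    exact Subsingleton.elim _ _

/-- Every morphism of a topos factors as an epimorphism followed by a monomorphism. The image of
`f : A ⟶ B` is the internal intersection of all the subobjects of `B` through which `f` factors:
`{b | ∀ U, (∀ a, f a ∈ U) → b ∈ U}`. -/
lemma exists_image {A B : C} (f : A ⟶ B) :
    ∃ (I : C) (e : A ⟶ I) (m : I ⟶ B), Epi e ∧ Mono m ∧ e ≫ m = f := by
  obtain ⟨PB, mem, hPB⟩ := exists_exponential B (Ω C)
  -- `K` consists of the `U` with `∀ a, f a ∈ U`.
  obtain ⟨K, κ, _, hκ⟩ := exists_forall (prod.map f (𝟙 PB) ≫ mem)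
  obtain ⟨I, m, _, hm⟩ := exists_forall (prod.lift prod.snd (prod.fst ≫ κ) ≫ mem : K ⨯ B ⟶ Ω C)
  have hf : Mem f m := by
    refine (hm f).2 fun Z a y ↦ ?_
    have := (hκ κ).1 (Mem.self κ) y a
    simpa [prod.lift_map_assoc, prod.comp_lift_assoc, prod.lift_fst_assoc, prod.lift_snd] using this
  obtain ⟨e, he⟩ := hf
  refine ⟨I, e, m, ⟨fun {X} u v huv ↦ ?_⟩, inferInstance, he⟩
  -- The equaliser of `u` and `v` is a subobject of `B` through which `f` factors; hence `I` is
  -- contained in it.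
  let n := equalizer.ι u v ≫ m
  obtain ⟨g, hg, -⟩ := hPB (prod.fst ≫ χ n : B ⨯ ⊤_ C ⟶ Ω C)
  have hgn {Z : C} (b : Z ⟶ B) : prod.lift b (terminal.from Z ≫ g) ≫ mem = b ≫ χ n := by
    have : prod.lift b (terminal.from Z ≫ g) =
        prod.lift b (terminal.from Z) ≫ prod.map (𝟙 B) g := by simp [prod.lift_map]
    rw [this, Category.assoc, hg, prod.lift_fst_assoc]
  have hfn : Mem f n := ⟨equalizer.lift e huv, by simp [n, he]⟩
  obtain ⟨k, hk⟩ : Mem g κ := by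
    refine (hκ g).2 fun Z a y ↦ ?_
    rw [prod.lift_map_assoc, Category.comp_id, Subsingleton.elim y (terminal.from Z), hgn,
      ← mem_iff_mem_truth]
    exact hfn.precomp a
  obtain ⟨y, hy⟩ : Mem m n := by
    rw [mem_iff_mem_truth, ← hgn, ← hk]
    have := (hm m).1 (Mem.self m) (terminal.from I ≫ k) (𝟙 I)
    simpa [prod.comp_lift_assoc, prod.lift_fst_assoc, prod.lift_snd] using this
  have : y ≫ equalizer.ι u v = 𝟙 I := by
    rw [← cancel_mono m, Category.assoc, hy, Category.id_comp]
  rw [← Category.id_comp u, ← Category.id_comp v, ← this, Category.assoc, equalizer.condition,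
    Category.assoc]

/-- Inverse image along the epimorphism `f` is injective on subobjects, because these are classified
by morphisms to `Ω`. If `snd` equalises `u` and `v`, the equaliser of `u` and `v` and the whole of
`Y` are subobjects of `Z` with the same inverse image, hence they are equal. -/
lemma epi_snd_of_isPullback_of_mono {P X Y Z : C} {fst : P ⟶ X} {snd : P ⟶ Y} {f : X ⟶ Z}
    {g : Y ⟶ Z} (h : IsPullback fst snd f g) [Epi f] [Mono g] : Epi snd := by
  refine ⟨fun {W} u v huv ↦ ?_⟩
  let n := equalizer.ι u v ≫ g
  have hχ : χ n = χ g := by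
    rw [← cancel_epi f]
    refine hom_Ω_ext fun X x ↦ ?_
    rw [← Category.assoc, ← Category.assoc, ← mem_iff_mem_truth, ← mem_iff_mem_truth]
    constructor
    · rintro ⟨y, hy⟩
      exact ⟨y ≫ equalizer.ι u v, by simpa [n] using hy⟩
    · rintro ⟨y, hy⟩
      have hl : h.lift x y hy.symm ≫ snd = y := h.lift_snd _ _ _
      have hy' : y ≫ u = y ≫ v := by
        rw [← hl, Category.assoc, huv, Category.assoc]
      exact ⟨equalizer.lift y hy', by simp [n, hy]⟩
  obtain ⟨y, hy⟩ : Mem g n := by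
    rw [mem_iff_mem_truth, hχ, ← mem_iff_mem_truth]
    exact Mem.self g
  have : y ≫ equalizer.ι u v = 𝟙 Y := by
    rw [← cancel_mono g, Category.assoc, hy, Category.id_comp]
  rw [← Category.id_comp u, ← Category.id_comp v, ← this, Category.assoc, equalizer.condition,
    Category.assoc]

lemma epi_snd_of_isPullback {P X Y Z : C} {fst : P ⟶ X} {snd : P ⟶ Y} {f : X ⟶ Z}
    {g : Y ⟶ Z} (h : IsPullback fst snd f g) [Epi f] : Epi snd := by
  have := IsTopos.hasExponentials Y
  have : Epi (prod.map (𝟙 Y) f) := inferInstanceAs (Epi ((prod.functor.obj Y).map f))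
  -- Replacing `g` by its graph reduces to the case of a monomorphism.
  have hg : Mono (prod.lift (𝟙 Y) g) := mono_of_mono_fac (prod.lift_fst _ _)
  refine epi_snd_of_isPullback_of_mono (fst := prod.lift snd fst) (f := prod.map (𝟙 Y) f)
    (g := prod.lift (𝟙 Y) g) (IsPullback.mk' ?_ ?_ ?_)
  · ext <;> simp [prod.lift_fst, prod.lift_snd, h.w]
  · intro T φ φ' h₁ h₂
    refine h.hom_ext ?_ h₂
    simpa [prod.lift_fst, prod.lift_snd] using h₁ =≫ prod.snd
  · intro T a b hab
    have h₁ : a ≫ prod.fst = b := by simpa [prod.lift_fst, prod.lift_snd] using hab =≫ prod.fst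
    have h₂ : (a ≫ prod.snd) ≫ f = b ≫ g := by
      simpa [prod.lift_snd] using hab =≫ prod.snd
    refine ⟨h.lift _ _ h₂, ?_, by simp⟩
    ext <;> simp [prod.lift_fst, prod.lift_snd, h₁]

/-- Generalised elements lift along an epimorphism after passing to a cover. -/
lemma exists_epi_lift {A B T : C} (q : A ⟶ B) [Epi q] (x : T ⟶ B) :
    ∃ (T' : C) (c : T' ⟶ T) (a : T' ⟶ A), Epi c ∧ a ≫ q = c ≫ x :=
  ⟨_, pullback.snd q x, pullback.fst q x,
    epi_snd_of_isPullback (IsPullback.of_hasPullback q x), pullback.condition⟩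

lemma isRegularEpi_of_epi {A B : C} (f : A ⟶ B) [Epi f] : IsRegularEpi f := by
  refine IsRegularEpi.of_epi_of_exists fun Z g hg ↦ ?_
  -- The image of `(f, g)` is the graph of the required morphism `B ⟶ Z`.
  obtain ⟨I, q, m, _, _, hm⟩ := exists_image (prod.lift f g)
  have hf : q ≫ m ≫ prod.fst = f := by rw [reassoc_of% hm, prod.lift_fst]
  have hg' : q ≫ m ≫ prod.snd = g := by rw [reassoc_of% hm, prod.lift_snd]
  have : Epi (m ≫ prod.fst) := by
    have : Epi (q ≫ m ≫ prod.fst) := by rw [hf]; infer_instance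
    exact epi_of_epi q _
  have : Mono (m ≫ prod.fst) := by
    refine ⟨fun {T} x y hxy ↦ ?_⟩
    obtain ⟨T₁, c₁, a, _, ha⟩ := exists_epi_lift q x
    obtain ⟨T₂, c₂, b, _, hb⟩ := exists_epi_lift q (c₁ ≫ y)
    have hab : (c₂ ≫ a) ≫ f = b ≫ f := by
      rw [← hf, Category.assoc, reassoc_of% ha, reassoc_of% hb, hxy]
    have hab' : (c₂ ≫ a) ≫ g = b ≫ g := by
      have := pullback.lift _ _ hab ≫= hg
      rwa [pullback.lift_fst_assoc, pullback.lift_snd_assoc] at this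
    rw [← cancel_epi c₁, ← cancel_epi c₂, ← cancel_mono m, ← ha, ← hb, Category.assoc,
      Category.assoc, Category.assoc, hm]
    ext
    · simpa [prod.lift_fst] using hab
    · simpa [prod.lift_snd] using hab'
  have : IsIso (m ≫ prod.fst) := isIso_of_mono_of_epi _
  refine ⟨inv (m ≫ prod.fst) ≫ m ≫ prod.snd, ?_⟩
  conv_lhs => rw [← hf]
  simp [hg']

/-- Membership in the image of `w`: being hit by `w` after passing to a cover. -/
lemma exists_mem_image {W B : C} (w : W ⟶ B) :
    ∃ (I : C) (m : I ⟶ B), Mono m ∧ ∀ ⦃X : C⦄ (x : X ⟶ B),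
      Mem x m ↔ ∃ (X' : C) (c : X' ⟶ X), Epi c ∧ Mem (c ≫ x) w := by
  obtain ⟨I, e, m, _, _, rfl⟩ := exists_image w
  refine ⟨I, m, inferInstance, fun X x ↦ ⟨?_, ?_⟩⟩
  · rintro ⟨y, rfl⟩
    obtain ⟨X', c, a, hc, ha⟩ := exists_epi_lift e y
    exact ⟨X', c, hc, a, by rw [reassoc_of% ha]⟩
  · rintro ⟨X', c, _, y, hy⟩
    exact Mem.of_epi (c := c) ⟨y ≫ e, by simpa using hy⟩

/-- The power object of `J`, as a generic family of subobjects of the objects `J ⨯ B`;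
uniqueness of the classifying morphism `ρ` is not recorded. -/
lemma exists_powerObject (J : C) :
    ∃ (Q M : C) (ε : M ⟶ J ⨯ Q), Mono ε ∧ ∀ ⦃B R : C⦄ (r : R ⟶ J ⨯ B), Mono r →
      ∃ (ρ : B ⟶ Q) (q : R ⟶ M), IsPullback q r ε (prod.map (𝟙 J) ρ) := by
  obtain ⟨Q, ev, hQ⟩ := exists_exponential J (Ω C)
  refine ⟨Q, _, pullback.fst ev (truth C), inferInstance, fun B R r _ ↦ ?_⟩
  obtain ⟨ρ, hρ, -⟩ := hQ (χ r)
  refine ⟨ρ, exists_isPullback_of_mem_iff fun X x ↦ ?_⟩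
  rw [mem_iff_mem_truth, ← hρ,
    mem_iff_of_isPullback (IsPullback.of_hasPullback ev (truth C)).flip, Category.assoc]

end Topos

/-! ### Generic families -/

section ProductComparison

variable {D : Type u₁} [Category.{v₁} D] [HasFiniteLimits D] {E : Type u₂} [Category.{v₂} E]
  (K : D ⥤ E) [PreservesFiniteLimits K]

lemma exists_lift_map_prod {A B : D} {X : E} (a : X ⟶ K.obj A) (b : X ⟶ K.obj B) :
    ∃ z : X ⟶ K.obj (A ⨯ B), z ≫ K.map prod.fst = a ∧ z ≫ K.map prod.snd = b :=
  have hl := isLimitOfHasBinaryProductOfPreservesLimit K A B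
  ⟨_, (BinaryFan.IsLimit.lift' hl a b).2⟩

lemma map_prod_hom_ext {A B : D} {X : E} {y z : X ⟶ K.obj (A ⨯ B)}
    (h₁ : y ≫ K.map prod.fst = z ≫ K.map prod.fst)
    (h₂ : y ≫ K.map prod.snd = z ≫ K.map prod.snd) : y = z :=
  BinaryFan.IsLimit.hom_ext (isLimitOfHasBinaryProductOfPreservesLimit K A B) h₁ h₂

end ProductComparison

/-- For a family `ε` of relations from `J` to `Q` and a predicate `τ` on `J`, there is a predicate
`g` on `Q` expressing `{s | ∃ j, ε(j, s) ∧ τ(j)}`, and this description is stable under pullback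
along the morphisms `K ρ`. -/
lemma exists_mono_forall_mem_map_iff {D : Type u₁} [Category.{v₁} D] [HasFiniteLimits D]
    {E : Type u₂} [Category.{v₂} E] [IsTopos E] (K : D ⥤ E) [PreservesFiniteLimits K]
    {J Q : D} {M T : E} (ε : M ⟶ K.obj (J ⨯ Q)) (τ : T ⟶ K.obj J) :
    ∃ (G : E) (g : G ⟶ K.obj Q), Mono g ∧
      ∀ ⦃B : D⦄ ⦃R : E⦄ (ρ : B ⟶ Q) (q : R ⟶ M) (r : R ⟶ K.obj (J ⨯ B)),
        IsPullback q r ε (K.map (prod.map (𝟙 J) ρ)) → ∀ ⦃X : E⦄ (x : X ⟶ K.obj B),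
          Mem (x ≫ K.map ρ) g ↔ ∃ (X' : E) (c : X' ⟶ X) (z : X' ⟶ K.obj (J ⨯ B)),
            Epi c ∧ Mem z r ∧ Mem (z ≫ K.map prod.fst) τ ∧ z ≫ K.map prod.snd = c ≫ x := by
  obtain ⟨G, g, hg, hmem⟩ :=
    exists_mem_image (pullback.fst (ε ≫ K.map prod.fst) τ ≫ ε ≫ K.map prod.snd)
  have fst_map {B : D} (ρ : B ⟶ Q) :
      K.map (prod.map (𝟙 J) ρ) ≫ K.map prod.fst = K.map prod.fst := by
    rw [← K.map_comp, prod.map_fst, Category.comp_id]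
  have snd_map {B : D} (ρ : B ⟶ Q) :
      K.map (prod.map (𝟙 J) ρ) ≫ K.map prod.snd = K.map prod.snd ≫ K.map ρ := by
    rw [← K.map_comp, prod.map_snd, K.map_comp]
  refine ⟨G, g, hg, fun B R ρ q r h X x ↦ ?_⟩
  rw [hmem]
  constructor
  · rintro ⟨X', c, hc, y, hy⟩
    obtain ⟨z, hz₁, hz₂⟩ := exists_lift_map_prod K (y ≫ pullback.fst _ _ ≫ ε ≫ K.map prod.fst)
      (c ≫ x)
    refine ⟨X', c, z, hc, ?_, ?_, hz₂⟩
    · rw [mem_iff_of_isPullback h]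
      refine ⟨y ≫ pullback.fst _ _, map_prod_hom_ext K ?_ ?_⟩
      · simp [fst_map, hz₁]
      · simp [snd_map, reassoc_of% hz₂, hy]
    · rw [hz₁, pullback.condition]
      exact ⟨y ≫ pullback.snd _ _, by simp⟩
  · rintro ⟨X', c, z, hc, hz, ⟨b, hb⟩, hzc⟩
    obtain ⟨a, ha⟩ := (mem_iff_of_isPullback h z).1 hz
    have hab : a ≫ ε ≫ K.map prod.fst = b ≫ τ := by
      rw [reassoc_of% ha, fst_map, hb]
    refine ⟨X', c, hc, pullback.lift a b hab, ?_⟩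
    rw [pullback.lift_fst_assoc, reassoc_of% ha, snd_map, reassoc_of% hzc]

lemma IsRegularFunctor.preservesEpimorphisms {E₁ : Type u₁} [Category.{v₁} E₁] [IsTopos E₁]
    {E₂ : Type u₂} [Category.{v₂} E₂]
    {H : E₁ ⥤ E₂} (hH : IsRegularFunctor H) :
    H.PreservesEpimorphisms where
  preserves f _ :=
    have := hH.map_regularEpi f (isRegularEpi_of_epi f)
    (IsRegularEpi.getStruct (H.map f)).epi

lemma IsSubquotient.trans_map {E₁ : Type u₁} [Category.{v₁} E₁]
    {E₂ : Type u₂} [Category.{v₂} E₂] [IsTopos E₂]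
    {A : E₂} {B B' : E₁} (H : E₁ ⥤ E₂)
    [PreservesFiniteLimits H] [H.PreservesEpimorphisms]
    (hA : IsSubquotient A (H.obj B)) (hB : IsSubquotient B B') :
    IsSubquotient A (H.obj B') := by
  obtain ⟨C, m, e, _, _⟩ := hA
  obtain ⟨C', m', e', _, _⟩ := hB
  have := epi_snd_of_isPullback (IsPullback.of_hasPullback (H.map e') m)
  exact ⟨pullback (H.map e') m, pullback.fst _ _ ≫ H.map m', pullback.snd _ _ ≫ e,
    mono_comp _ _, epi_comp _ _⟩

/-- If `t` is generic for `F ⋙ H` over `Sg`, the power object of `F Sg` carries a generic family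
for `H`: a predicate on `H B` is determined by its inverse image on `H C`, for a subobject `C` of
some `F I` that covers `B`; the latter is classified by some `p : I ⟶ Sg`, and `b : B` is sent to
`{p i | i ∈ C lies over b}`. -/
lemma IsGenericFamily.of_comp {S : Type u₀} [Category.{v₀} S]
    {E₁ : Type u₁} [Category.{v₁} E₁] [IsTopos E₁] {E₂ : Type u₂} [Category.{v₂} E₂] [IsTopos E₂]
    (F : S ⥤ E₁) (hF : ∀ B : E₁, ∃ I : S, IsSubquotient B (F.obj I))
    (H : E₁ ⥤ E₂) [PreservesFiniteLimits H] [H.PreservesEpimorphisms]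
    {Sg : S} {T : E₂} {t : T ⟶ (F ⋙ H).obj Sg} (ht : IsGenericFamily (F ⋙ H) t) :
    ∃ (Sg' : E₁) (T' : E₂) (t' : T' ⟶ H.obj Sg'), IsGenericFamily H t' := by
  obtain ⟨_, ht⟩ := ht
  obtain ⟨Q, M, ε, _, hε⟩ := exists_powerObject (F.obj Sg)
  obtain ⟨G, g, _, hg⟩ := exists_mono_forall_mem_map_iff H (H.map ε) t
  refine ⟨Q, G, g, inferInstance, fun B P m _ ↦ ?_⟩
  obtain ⟨I, C, c, e, _, _⟩ := hF B
  obtain ⟨p, q₀, hp⟩ := ht I _ (pullback.snd m (H.map e) ≫ H.map c) inferInstance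
  -- The inverse image of `m` on `H C` is the restriction to `H C` of the predicate `t` of `p`.
  have hpC ⦃X : E₂⦄ (z : X ⟶ H.obj C) :
      Mem (z ≫ H.map e) m ↔ Mem (z ≫ H.map c ≫ H.map (F.map p)) t := by
    rw [← mem_iff_of_isPullback (IsPullback.of_hasPullback m (H.map e)), ← Category.assoc]
    refine Iff.trans ?_ (mem_iff_of_isPullback hp (z ≫ H.map c))
    constructor
    · rintro ⟨y, rfl⟩
      exact ⟨y, by simp⟩
    · rintro ⟨y, hy⟩
      exact ⟨y, by rwa [← Category.assoc, cancel_mono] at hy⟩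
  obtain ⟨R, e', r, _, _, hr⟩ := exists_image (prod.lift (c ≫ F.map p) e)
  obtain ⟨ρ, q, hρ⟩ := hε r inferInstance
  have hr₁ : H.map e' ≫ H.map r ≫ H.map prod.fst = H.map c ≫ H.map (F.map p) := by
    simp only [← H.map_comp]
    rw [reassoc_of% hr, prod.lift_fst]
  have hr₂ : H.map e' ≫ H.map r ≫ H.map prod.snd = H.map e := by
    simp only [← H.map_comp]
    rw [reassoc_of% hr, prod.lift_snd]
  refine ⟨ρ, exists_isPullback_of_mem_iff fun X x ↦ ?_⟩
  rw [hg ρ (H.map q) (H.map r) (hρ.map H)]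
  constructor
  · intro hx
    obtain ⟨X', k, a, hk, ha⟩ := exists_epi_lift (H.map e) x
    refine ⟨X', k, a ≫ H.map e' ≫ H.map r, hk, ⟨a ≫ H.map e', by simp⟩, ?_, ?_⟩
    · rw [Category.assoc, Category.assoc, hr₁, ← hpC, ha]
      exact hx.precomp k
    · rw [Category.assoc, Category.assoc, hr₂, ha]
  · rintro ⟨X', k, z, hk, ⟨y, rfl⟩, hzt, hzx⟩
    obtain ⟨X'', k', a, hk', ha⟩ := exists_epi_lift (H.map e') y
    refine Mem.of_epi (c := k) (Mem.of_epi (c := k') ?_)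
    rw [← hzx, Category.assoc, ← reassoc_of% ha, hr₂, hpC, ← hr₁, reassoc_of% ha]
    simpa using hzt.precomp k'

/-- If `t₁` over `Sg₁` is generic for `F` and `t` over `Sg` is generic for `H`, cover `Sg` by a
subobject `C` of some `F J`. The exponential `Sg₁ ^ J` carries a generic family for `F ⋙ H`: a
predicate on `H (F I)` is classified by some `p : F I ⟶ Sg`, and the relation
`{(j, i) | j ∈ C lies over p i}` from `F J` to `F I` is classified by some `J ⨯ I ⟶ Sg₁`. -/
lemma IsGenericFamily.comp {S : Type u₀} [Category.{v₀} S] [IsTopos S]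
    {E₁ : Type u₁} [Category.{v₁} E₁] [IsTopos E₁] {E₂ : Type u₂} [Category.{v₂} E₂] [IsTopos E₂]
    (F : S ⥤ E₁) (hF : ∀ B : E₁, ∃ I : S, IsSubquotient B (F.obj I))
    [PreservesFiniteLimits F] (H : E₁ ⥤ E₂) [PreservesFiniteLimits H] [H.PreservesEpimorphisms]
    {Sg₁ : S} {T₁ : E₁} {t₁ : T₁ ⟶ F.obj Sg₁} (ht₁ : IsGenericFamily F t₁)
    {Sg : E₁} {T : E₂} {t : T ⟶ H.obj Sg} (ht : IsGenericFamily H t) :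
    ∃ (Sg' : S) (T' : E₂) (t' : T' ⟶ (F ⋙ H).obj Sg'), IsGenericFamily (F ⋙ H) t' := by
  obtain ⟨_, ht₁⟩ := ht₁
  obtain ⟨_, ht⟩ := ht
  obtain ⟨J, C, c, e, _, _⟩ := hF Sg
  obtain ⟨Q, ev, hQ⟩ := exists_exponential J Sg₁
  let u := pullback.snd t₁ (F.map ev)
  obtain ⟨G, g, _, hg⟩ := exists_mono_forall_mem_map_iff (F ⋙ H) (J := J) (Q := Q) (H.map u)
    (pullback.snd t (H.map e) ≫ H.map c)
  refine ⟨Q, G, g, inferInstance, fun I P m _ ↦ ?_⟩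
  obtain ⟨p, q₀, hp⟩ := ht (F.obj I) P m inferInstance
  obtain ⟨r, hr₁, hr₂⟩ := exists_lift_map_prod F (pullback.fst e p ≫ c) (pullback.snd e p)
  have : Mono r := by
    refine ⟨fun {Z} a b hab ↦ ?_⟩
    apply pullback.hom_ext
    · rw [← cancel_mono c, Category.assoc, Category.assoc, ← hr₁, reassoc_of% hab]
    · rw [← hr₂, reassoc_of% hab]
  obtain ⟨p', q', hp'⟩ := ht₁ (J ⨯ I) _ r inferInstance
  obtain ⟨ρ, hρ, -⟩ := hQ p'
  obtain ⟨q, hq⟩ : ∃ q, IsPullback q r u (F.map (prod.map (𝟙 J) ρ)) := by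
    refine exists_isPullback_of_mem_iff fun X x ↦ ?_
    rw [mem_iff_of_isPullback hp', mem_iff_of_isPullback (IsPullback.of_hasPullback t₁ (F.map ev)),
      ← hρ, F.map_comp, Category.assoc]
  have hR : IsPullback (H.map (pullback.fst e p)) (H.map (pullback.snd e p)) (H.map e) (H.map p) :=
    (IsPullback.of_hasPullback e p).map H
  have hr₁' : H.map r ≫ (F ⋙ H).map prod.fst = H.map (pullback.fst e p) ≫ H.map c := by
    rw [Functor.comp_map, ← H.map_comp, hr₁, H.map_comp]
  have hr₂' : H.map r ≫ (F ⋙ H).map prod.snd = H.map (pullback.snd e p) := by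
    rw [Functor.comp_map, ← H.map_comp, hr₂]
  refine ⟨ρ, exists_isPullback_of_mem_iff fun X x ↦ ?_⟩
  rw [hg ρ (H.map q) (H.map r) (hq.map H)]
  constructor
  · intro hx
    rw [mem_iff_of_isPullback hp] at hx
    obtain ⟨X', k, a, hk, ha⟩ := exists_epi_lift (H.map e) (x ≫ H.map p)
    rw [← Category.assoc] at ha
    refine ⟨X', k, hR.lift a _ ha ≫ H.map r, hk, ⟨_, rfl⟩, ?_, ?_⟩
    · obtain ⟨b, hb⟩ : Mem a (pullback.snd t (H.map e)) := by
        rw [mem_iff_of_isPullback (IsPullback.of_hasPullback t (H.map e)), ha, Category.assoc]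
        exact hx.precomp k
      rw [Category.assoc, hr₁', hR.lift_fst_assoc]
      exact ⟨b, by rw [reassoc_of% hb]⟩
    · rw [Category.assoc, hr₂', hR.lift_snd]
  · rintro ⟨X', k, z, hk, ⟨y, rfl⟩, ⟨b, hb⟩, hzx⟩
    refine Mem.of_epi (c := k) ?_
    have hy : Mem (y ≫ H.map (pullback.fst e p)) (pullback.snd t (H.map e)) := by
      refine ⟨b, ?_⟩
      rw [← cancel_mono (H.map c), Category.assoc, hb, Category.assoc, hr₁', Category.assoc]
    rw [mem_iff_of_isPullback (IsPullback.of_hasPullback t (H.map e)), Category.assoc, hR.w] at hy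
    have hzx' : y ≫ H.map (pullback.snd e p) = k ≫ x := by
      rw [← hr₂', ← Category.assoc]
      exact hzx
    rw [mem_iff_of_isPullback hp, ← hzx', Category.assoc]
    exact hy

theorem mainTheorem1
    {S : Type u₀} [Category.{v₀} S] [IsTopos S]
    {E₁ : Type u₁} [Category.{v₁} E₁] [IsTopos E₁]
    {E₂ : Type u₂} [Category.{v₂} E₂] [IsTopos E₂]
    (F₁ : S ⥤ E₁) (hF₁ : IsTraditionalRegularTripos F₁)
    (H : E₁ ⥤ E₂) (hH : IsRegularFunctor H) :
    IsTraditionalRegularTripos H ↔ IsTraditionalRegularTripos (F₁ ⋙ H) := by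
  have := hH.preservesFiniteLimits
  have := hH.preservesEpimorphisms
  have := hF₁.isTripos.preservesFiniteLimits
  have := hF₁.regular
  have hsub := hF₁.isTripos.exists_isSubquotient
  constructor
  · intro h
    refine ⟨⟨inferInstance, fun A ↦ ?_⟩, ?_, inferInstance⟩
    · obtain ⟨B, hA⟩ := h.isTripos.exists_isSubquotient A
      obtain ⟨I, hB⟩ := hsub B
      exact ⟨I, hA.trans_map H hB⟩
    · obtain ⟨Sg₁, T₁, t₁, ht₁⟩ := hF₁.traditional
      obtain ⟨Sg, T, t, ht⟩ := h.traditional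
      exact IsGenericFamily.comp F₁ hsub H ht₁ ht
  · intro h
    refine ⟨⟨inferInstance, fun A ↦ ?_⟩, ?_, inferInstance⟩
    · obtain ⟨I, hA⟩ := h.isTripos.exists_isSubquotient A
      exact ⟨F₁.obj I, hA⟩
    · obtain ⟨Sg, T, t, ht⟩ := h.traditional
      exact IsGenericFamily.of_comp F₁ hsub H ht
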